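/- For finite sets $B,C\subset\mathbb{R}$ write $$E_+(B,C)=\#\{(b_1,b_2,c_1,c_2)\in B^2\times C^2: b_1+c_1=b_2+c_2\},\qquad E_\times(B,C)=\#\{(b_1,b_2,c_1,c_2)\in B^2\times C^2: b_1c_1=b_2c_2\},$$ and put $E_+(B)=E_+(B,B)$, $E_\times(C)=E_\times(C,C)$. **Theorem 1.1.** Let $\delta=\frac{2}{33}$. There is an absolute constant $K>0$ such that, for every finite set $A\subset\mathbb{R}$ with $|A|\ge 2$, there exist disjoint subsets $B$ and $C$ of $A$ with $A=B\cup C$, $$\max\{E_+(B),E_\times(C)\}\le K\,|A|^{3-\delta}(\log|A|)^{1-\delta}$$ and $$\max\{E_+(B,C),E_\times(B,C)\}\le K\,|A|^{3-\delta/2}(\log|A|)^{(1-\delta)/2}.$$ -/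

import Mathlib

open Finset
open scoped Pointwise

/-! Write n = |A|. While what remains of A has additive energy above 12n^(3-δ),
Balog–Szemerédi–Gowers (`exists_subset_small_sumset`) yields a piece of size ≫ n^(1-δ) whose sumset
is ≪ n^(1+3δ). By Solymosi's sector argument (`mulEnergy_self_le_of_pos`), the positive or negative
part of the piece then has multiplicative energy ≪ n^(2+6δ) log n. Such parts are moved into C; what
is left at the end is B.

The fourth root of multiplicative energy is subadditive on sets avoiding 0 (`mulEnergy_union_le`),
and C is made of ≪ n^δ parts, so E_×(C) ≪ n^(2+10δ) log n. This is ≪ n^(3-δ) whenever 11δ < 1, the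
slack absorbing the logarithm. Since 2/33 < 1/11, a bound without logarithms results. The mixed
energies follow by Cauchy–Schwarz against the trivial cubic bounds. -/

section FiberPairs

/-! ### Coincidence counts as inner products of fibre-size functions -/

variable {ι κ γ : Type*} [DecidableEq γ]

/-- The number of pairs `(s, t) ∈ S × T` with `f s = g t`. -/
def fiberPairs (S : Finset ι) (T : Finset κ) (f : ι → γ) (g : κ → γ) : ℕ :=
  #{p ∈ S ×ˢ T | f p.1 = g p.2}

lemma fiberPairs_eq_sum (S : Finset ι) (T : Finset κ) (f : ι → γ) (g : κ → γ) (I : Finset γ)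
    (hI : ∀ s ∈ S, f s ∈ I) :
    fiberPairs S T f g = ∑ c ∈ I, #{s ∈ S | f s = c} * #{t ∈ T | g t = c} := by
  rw [fiberPairs, card_eq_sum_card_fiberwise (f := fun p : ι × κ => f p.1) (t := I)]
  · refine sum_congr rfl fun c _ => ?_
    rw [← card_product]
    congr 1
    ext ⟨s, t⟩
    simp only [mem_filter, mem_product]
    constructor
    · rintro ⟨⟨⟨hs, ht⟩, h⟩, rfl⟩
      exact ⟨⟨hs, rfl⟩, ht, h.symm⟩
    · rintro ⟨⟨hs, rfl⟩, ht, h⟩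
      exact ⟨⟨⟨hs, ht⟩, h.symm⟩, rfl⟩
  · rintro ⟨s, t⟩ h
    simp only [coe_filter, mem_product, Set.mem_ofPred_eq] at h
    exact hI s h.1.1

lemma fiberPairs_self_eq_sum (S : Finset ι) (f : ι → γ) (I : Finset γ) (hI : ∀ s ∈ S, f s ∈ I) :
    fiberPairs S S f f = ∑ c ∈ I, #{s ∈ S | f s = c} ^ 2 := by
  rw [fiberPairs_eq_sum S S f f I hI]
  simp only [sq]

lemma fiberPairs_sq_le (S : Finset ι) (T : Finset κ) (f : ι → γ) (g : κ → γ) :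
    fiberPairs S T f g ^ 2 ≤ fiberPairs S S f f * fiberPairs T T g g := by
  classical
  have hS : ∀ s ∈ S, f s ∈ S.image f ∪ T.image g := fun s hs =>
    mem_union_left _ (mem_image_of_mem f hs)
  have hT : ∀ t ∈ T, g t ∈ S.image f ∪ T.image g := fun t ht =>
    mem_union_right _ (mem_image_of_mem g ht)
  rw [fiberPairs_eq_sum S T f g _ hS, fiberPairs_self_eq_sum S f _ hS,
    fiberPairs_self_eq_sum T g _ hT]
  exact sum_mul_sq_le_sq_mul_sq _ _ _

lemma fiberPairs_le_sqrt_mul_sqrt (S : Finset ι) (T : Finset κ) (f : ι → γ) (g : κ → γ) :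
    (fiberPairs S T f g : ℝ) ≤ √(fiberPairs S S f f) * √(fiberPairs T T g g) := by
  rw [← Real.sqrt_mul (Nat.cast_nonneg _)]
  apply Real.le_sqrt_of_sq_le
  exact_mod_cast fiberPairs_sq_le S T f g

/-- Triangle inequality: the square root is the ℓ² norm of the fibre-size function, and overlap of
`S` and `T` only helps. -/
lemma sqrt_fiberPairs_union_le [DecidableEq ι] (S T : Finset ι) (f : ι → γ) :
    √(fiberPairs (S ∪ T) (S ∪ T) f f) ≤ √(fiberPairs S S f f) + √(fiberPairs T T f f) := by
  have h : fiberPairs (S ∪ T) (S ∪ T) f f ≤ (fiberPairs S S f f + fiberPairs S T f f) +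
      (fiberPairs T S f f + fiberPairs T T f f) := by
    unfold fiberPairs
    rw [union_product, product_union, product_union, filter_union, filter_union, filter_union]
    exact (card_union_le _ _).trans (add_le_add (card_union_le _ _) (card_union_le _ _))
  have h' : (fiberPairs (S ∪ T) (S ∪ T) f f : ℝ) ≤ (fiberPairs S S f f + fiberPairs S T f f) +
      (fiberPairs T S f f + fiberPairs T T f f) := by exact_mod_cast h
  have h1 := fiberPairs_le_sqrt_mul_sqrt S T f f
  have h2 := fiberPairs_le_sqrt_mul_sqrt T S f f
  apply Real.sqrt_le_iff.2 ⟨by positivity, ?_⟩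
  have e1 := Real.sq_sqrt (Nat.cast_nonneg (α := ℝ) (fiberPairs S S f f))
  have e2 := Real.sq_sqrt (Nat.cast_nonneg (α := ℝ) (fiberPairs T T f f))
  nlinarith

end FiberPairs

/-! ### Cauchy–Schwarz, subadditivity and trivial bounds for energies -/

lemma mulEnergy_eq_fiberPairs (X Z : Finset ℝ) :
    mulEnergy X Z = fiberPairs (X ×ˢ Z) (X ×ˢ Z) (fun p => p.1 * p.2) (fun p => p.1 * p.2) :=
  mulEnergy_eq_card_filter X Z

lemma sqrt_mulEnergy_union_left_le (X Y Z : Finset ℝ) :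
    √(mulEnergy (X ∪ Y) Z) ≤ √(mulEnergy X Z) + √(mulEnergy Y Z) := by
  simp only [mulEnergy_eq_fiberPairs, union_product]
  exact sqrt_fiberPairs_union_le _ _ _

lemma mulEnergy_self_eq_fiberPairs_div {X : Finset ℝ} (hX : 0 ∉ X) :
    mulEnergy X X = fiberPairs (X ×ˢ X) (X ×ˢ X) (fun p => p.1 / p.2) (fun p => p.1 / p.2) := by
  unfold mulEnergy fiberPairs
  refine card_equiv (Equiv.prodCongr (Equiv.refl _) (Equiv.prodComm _ _)) ?_
  rintro ⟨⟨a, b⟩, c, d⟩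
  simp only [mem_filter, mem_product, Equiv.prodCongr_apply, Equiv.coe_refl, Prod.map_apply, id,
    Equiv.prodComm_apply, Prod.swap_prod_mk]
  have key : b ∈ X → c ∈ X → (a * c = b * d ↔ a / b = d / c) := fun hb hc => by
    rw [div_eq_div_iff (ne_of_mem_of_not_mem hb hX) (ne_of_mem_of_not_mem hc hX), mul_comm b d]
  tauto

lemma mulEnergy_self_eq_fiberPairs_div' {X : Finset ℝ} (hX : 0 ∉ X) :
    mulEnergy X X = fiberPairs (X ×ˢ X) (X ×ˢ X) (fun p => p.2 / p.1) (fun p => p.2 / p.1) := by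
  unfold mulEnergy fiberPairs
  refine card_equiv (Equiv.prodCongr (Equiv.refl _) (Equiv.prodComm _ _)) ?_
  rintro ⟨⟨a, b⟩, c, d⟩
  simp only [mem_filter, mem_product, Equiv.prodCongr_apply, Equiv.coe_refl, Prod.map_apply, id,
    Equiv.prodComm_apply, Prod.swap_prod_mk]
  have key : a ∈ X → d ∈ X → (a * c = b * d ↔ b / a = c / d) := fun ha hd => by
    rw [div_eq_div_iff (ne_of_mem_of_not_mem ha hX) (ne_of_mem_of_not_mem hd hX), mul_comm c a,
      eq_comm]
  tauto

/-- Away from 0, ac = bd reads a/b = d/c, which separates the variables of `X` from those of `Z` for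
Cauchy–Schwarz. -/
lemma mulEnergy_le_sqrt_mul_sqrt {X Z : Finset ℝ} (hX : 0 ∉ X) (hZ : 0 ∉ Z) :
    (mulEnergy X Z : ℝ) ≤ √(mulEnergy X X) * √(mulEnergy Z Z) := by
  have h : mulEnergy X Z =
      fiberPairs (X ×ˢ X) (Z ×ˢ Z) (fun p => p.1 / p.2) (fun p => p.2 / p.1) := by
    unfold mulEnergy fiberPairs
    congr 1
    refine filter_congr ?_
    rintro ⟨⟨a, b⟩, c, d⟩ h
    simp only [mem_product] at h
    rw [div_eq_div_iff (ne_of_mem_of_not_mem h.1.2 hX) (ne_of_mem_of_not_mem h.2.1 hZ),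
      mul_comm b d]
  rw [h, mulEnergy_self_eq_fiberPairs_div hX, mulEnergy_self_eq_fiberPairs_div' hZ]
  exact fiberPairs_le_sqrt_mul_sqrt _ _ _ _

lemma addEnergy_self_eq_fiberPairs_sub (X : Finset ℝ) :
    addEnergy X X = fiberPairs (X ×ˢ X) (X ×ˢ X) (fun p => p.1 - p.2) (fun p => p.1 - p.2) := by
  unfold addEnergy fiberPairs
  refine card_equiv (Equiv.prodCongr (Equiv.refl _) (Equiv.prodComm _ _)) ?_
  rintro ⟨⟨a, b⟩, c, d⟩
  simp only [mem_filter, mem_product, Equiv.prodCongr_apply, Equiv.coe_refl, Prod.map_apply, id,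
    Equiv.prodComm_apply, Prod.swap_prod_mk]
  rw [sub_eq_sub_iff_add_eq_add, add_comm b d]
  tauto

lemma addEnergy_self_eq_fiberPairs_sub' (X : Finset ℝ) :
    addEnergy X X = fiberPairs (X ×ˢ X) (X ×ˢ X) (fun p => p.2 - p.1) (fun p => p.2 - p.1) := by
  rw [addEnergy_self_eq_fiberPairs_sub]
  unfold fiberPairs
  congr 1
  refine filter_congr fun p _ => ?_
  dsimp only
  rw [← neg_sub p.1.2, ← neg_sub p.2.2, neg_inj]

lemma addEnergy_le_sqrt_mul_sqrt (X Z : Finset ℝ) :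
    (addEnergy X Z : ℝ) ≤ √(addEnergy X X) * √(addEnergy Z Z) := by
  have h : addEnergy X Z =
      fiberPairs (X ×ˢ X) (Z ×ˢ Z) (fun p => p.1 - p.2) (fun p => p.2 - p.1) := by
    unfold addEnergy fiberPairs
    congr 1
    refine filter_congr ?_
    rintro ⟨⟨a, b⟩, c, d⟩ h
    rw [sub_eq_sub_iff_add_eq_add, add_comm b d]
  rw [h, addEnergy_self_eq_fiberPairs_sub X, addEnergy_self_eq_fiberPairs_sub' Z]
  exact fiberPairs_le_sqrt_mul_sqrt _ _ _ _

/-- With e the energy of the union, √e ≤ √E(X, X ∪ Y) + √E(Y, X ∪ Y) ≤ (x + y)e^(1/4); cancel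
e^(1/4). -/
lemma mulEnergy_union_le {X Y : Finset ℝ} (hX : 0 ∉ X) (hY : 0 ∉ Y) {x y : ℝ} (hx : 0 ≤ x)
    (hy : 0 ≤ y) (hXx : (mulEnergy X X : ℝ) ≤ x ^ 4) (hYy : (mulEnergy Y Y : ℝ) ≤ y ^ 4) :
    (mulEnergy (X ∪ Y) (X ∪ Y) : ℝ) ≤ (x + y) ^ 4 := by
  set e : ℝ := (mulEnergy (X ∪ Y) (X ∪ Y) : ℝ) with he
  have hU : (0 : ℝ) ∉ X ∪ Y := by simp [hX, hY]
  have root : ∀ {W : Finset ℝ} {w : ℝ}, 0 ∉ W → 0 ≤ w → (mulEnergy W W : ℝ) ≤ w ^ 4 →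
      √(mulEnergy W (X ∪ Y)) ≤ w * √√e := by
    intro W w hW hw h
    have h1 : √(mulEnergy W W : ℝ) ≤ w ^ 2 := Real.sqrt_le_iff.2 ⟨by positivity, by
      rw [← pow_mul]; exact h⟩
    apply Real.sqrt_le_iff.2 ⟨by positivity, ?_⟩
    rw [mul_pow, Real.sq_sqrt (Real.sqrt_nonneg _)]
    exact (mulEnergy_le_sqrt_mul_sqrt hW hU).trans (by gcongr)
  have h1 : √e ≤ (x + y) * √√e := by
    rw [add_mul]
    exact (sqrt_mulEnergy_union_left_le X Y _).trans
      (add_le_add (root hX hx hXx) (root hY hy hYy))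
  have h2 : √√e ≤ x + y := by
    by_contra! hlt
    have := Real.sq_sqrt (Real.sqrt_nonneg e)
    nlinarith [Real.sqrt_nonneg √e]
  have h3 : √√e ^ 4 = e := by
    rw [show 4 = 2 * 2 by norm_num, pow_mul, Real.sq_sqrt (Real.sqrt_nonneg _),
      Real.sq_sqrt (Nat.cast_nonneg _)]
  rw [← h3]
  gcongr

lemma addEnergy_self_le (X : Finset ℝ) : addEnergy X X ≤ #X ^ 3 := by
  have : addEnergy X X ≤ #((X ×ˢ X) ×ˢ X) := by
    refine card_le_card_of_injOn (fun q => (q.1, q.2.1)) ?_ ?_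
    · rintro ⟨⟨a, b⟩, c, d⟩ h
      simp only [coe_filter, mem_product, Set.mem_ofPred_eq] at h
      simp [h]
    · rintro ⟨⟨a, b⟩, c, d⟩ h ⟨⟨a', b'⟩, c', d'⟩ h' he
      simp only [coe_filter, mem_product, Set.mem_ofPred_eq, Prod.mk.injEq] at h h' he ⊢
      obtain ⟨⟨rfl, rfl⟩, rfl⟩ := he
      exact ⟨⟨rfl, rfl⟩, rfl, by linarith⟩
  simpa [card_product, pow_succ] using this

lemma mulEnergy_self_le {X : Finset ℝ} (hX : 0 ∉ X) : mulEnergy X X ≤ #X ^ 3 := by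
  have : mulEnergy X X ≤ #((X ×ˢ X) ×ˢ X) := by
    refine card_le_card_of_injOn (fun q => (q.1, q.2.1)) ?_ ?_
    · rintro ⟨⟨a, b⟩, c, d⟩ h
      simp only [coe_filter, mem_product, Set.mem_ofPred_eq] at h
      simp [h]
    · rintro ⟨⟨a, b⟩, c, d⟩ h ⟨⟨a', b'⟩, c', d'⟩ h' he
      simp only [coe_filter, mem_product, Set.mem_ofPred_eq, Prod.mk.injEq] at h h' he ⊢
      obtain ⟨⟨rfl, rfl⟩, rfl⟩ := he
      exact ⟨⟨rfl, rfl⟩, rfl, mul_left_cancel₀ (ne_of_mem_of_not_mem h.1.1.2 hX)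
        (h.2.symm.trans h'.2)⟩
  simpa [card_product, pow_succ] using this

lemma mulEnergy_singleton_zero_left {Z : Finset ℝ} : mulEnergy {0} Z = #Z ^ 2 := by
  unfold mulEnergy
  rw [filter_true_of_mem, card_product, card_product, card_product, card_singleton, one_mul,
    one_mul, sq]
  rintro ⟨⟨a, b⟩, c, d⟩ h
  simp only [mem_product, mem_singleton] at h
  simp [h.1.1, h.1.2]

open scoped Pointwise in
lemma mulEnergy_neg_neg (X : Finset ℝ) : mulEnergy (-X) (-X) = mulEnergy X X := by
  unfold mulEnergy
  let e := Equiv.neg ℝ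
  refine card_equiv (Equiv.prodCongr (Equiv.prodCongr e e) (Equiv.prodCongr e e)) ?_
  rintro ⟨⟨a, b⟩, c, d⟩
  simp [e]

/-! ### Balog–Szemerédi–Gowers -/

/-- The number of representations of `d` as a difference of two elements of `A`. -/
noncomputable def diffCount (A : Finset ℝ) (d : ℝ) : ℕ := #{p ∈ A ×ˢ A | p.1 - p.2 = d}

lemma sum_diffCount_le (A D : Finset ℝ) : ∑ d ∈ D, diffCount A d ≤ #A ^ 2 := by
  unfold diffCount
  rw [sum_card_fiberwise_eq_card_filter, sq, ← card_product]
  exact card_filter_le _ _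

lemma sum_diffCount_mul_diffCount_le (A D S : Finset ℝ) (x : ℝ) :
    ∑ s ∈ S, ∑ d ∈ D, diffCount A d * diffCount A (s - x - d) ≤ #A ^ 4 := by
  rw [sum_comm]
  calc ∑ d ∈ D, ∑ s ∈ S, diffCount A d * diffCount A (s - x - d)
      ≤ ∑ d ∈ D, diffCount A d * #A ^ 2 := by
        refine sum_le_sum fun d _ => ?_
        rw [← mul_sum]
        gcongr
        rw [← sum_image (g := fun s => s - x - d) (f := diffCount A)
          (fun a _ b _ h => by simpa using h)]
        exact sum_diffCount_le A _
    _ ≤ #A ^ 2 * #A ^ 2 := by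
        rw [← sum_mul]
        gcongr
        exact sum_diffCount_le A D
    _ = #A ^ 4 := by ring

/-- `A ∩ (x - A)`. -/
noncomputable def reflectInter (A : Finset ℝ) (x : ℝ) : Finset ℝ := {a ∈ A | x - a ∈ A}

lemma card_reflectInter (A : Finset ℝ) (x : ℝ) :
    #(reflectInter A x) = #{p ∈ A ×ˢ A | p.1 + p.2 = x} := by
  refine card_bij' (fun a _ => (a, x - a)) (fun p _ => p.1) ?_ ?_ ?_ ?_
  · intro a h
    simpa [reflectInter] using h
  · rintro ⟨a, b⟩ h
    simp only [mem_filter, mem_product, reflectInter] at h ⊢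
    obtain ⟨⟨ha, hb⟩, rfl⟩ := h
    simp [ha, hb]
  · intros; rfl
  · rintro ⟨a, b⟩ h
    simp only [mem_filter, mem_product] at h
    rw [← h.2]
    simp

lemma sub_mem_reflectInter {A : Finset ℝ} {x a : ℝ} (h : a ∈ reflectInter A x) :
    x - a ∈ reflectInter A x := by
  simp only [reflectInter, mem_filter] at h ⊢
  simpa using h.symm

lemma addEnergy_eq_sum_card_reflectInter_sq (A : Finset ℝ) :
    addEnergy A A = ∑ x ∈ A + A, #(reflectInter A x) ^ 2 := by
  simp only [addEnergy_eq_sum_sq', card_reflectInter]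

lemma sum_card_reflectInter_le (A X : Finset ℝ) : ∑ x ∈ X, #(reflectInter A x) ≤ #A ^ 2 := by
  simp only [card_reflectInter]
  rw [sum_card_fiberwise_eq_card_filter, sq, ← card_product]
  exact card_filter_le _ _

/-- Double counting: if a and b both lie in `reflectInter A x`, then (x - b) - (x - a) represents a
- b, so an unpopular pair occurs for fewer than τ values of x. -/
lemma sum_card_unpopular_le (A X : Finset ℝ) {τ : ℝ} (hτ : 0 ≤ τ) :
    (∑ x ∈ X, #{p ∈ reflectInter A x ×ˢ reflectInter A x | (diffCount A (p.1 - p.2) : ℝ) < τ} : ℝ)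
      ≤ #A ^ 2 * τ := by
  have key : ∑ x ∈ X,
      #{p ∈ reflectInter A x ×ˢ reflectInter A x | (diffCount A (p.1 - p.2) : ℝ) < τ} =
      ∑ p ∈ (A ×ˢ A) with (diffCount A (p.1 - p.2) : ℝ) < τ, #{x ∈ X | x - p.1 ∈ A ∧ x - p.2 ∈ A} := by
    refine Eq.trans ?_ (sum_card_bipartiteAbove_eq_sum_card_bipartiteBelow
      (fun (x : ℝ) (p : ℝ × ℝ) => x - p.1 ∈ A ∧ x - p.2 ∈ A))
    refine sum_congr rfl fun x _ => ?_
    congr 1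
    ext ⟨a, b⟩
    simp only [bipartiteAbove, mem_filter, mem_product, reflectInter]
    tauto
  have hle : ∀ p ∈ (A ×ˢ A).filter (fun p => (diffCount A (p.1 - p.2) : ℝ) < τ),
      (#{x ∈ X | x - p.1 ∈ A ∧ x - p.2 ∈ A} : ℝ) ≤ τ := by
    rintro ⟨a, b⟩ hp
    refine le_trans ?_ (mem_filter.1 hp).2.le
    norm_cast
    refine card_le_card_of_injOn (fun x => (x - b, x - a)) ?_ ?_
    · intro x hx
      simp only [coe_filter, Set.mem_ofPred_eq, mem_product] at hx ⊢
      exact ⟨⟨hx.2.2, hx.2.1⟩, by ring⟩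
    · intro x _ y _ h
      simpa using h
  have := sum_le_card_nsmul _ _ _ hle
  rw [nsmul_eq_mul] at this
  have hc : (#((A ×ˢ A).filter (fun p => (diffCount A (p.1 - p.2) : ℝ) < τ)) : ℝ) ≤ #A ^ 2 := by
    norm_cast
    refine (card_filter_le _ _).trans ?_
    rw [card_product, sq]
  have key' : (∑ x ∈ X, #{p ∈ reflectInter A x ×ˢ reflectInter A x |
      (diffCount A (p.1 - p.2) : ℝ) < τ} : ℝ) = ∑ p ∈ (A ×ˢ A) with
        (diffCount A (p.1 - p.2) : ℝ) < τ, (#{x ∈ X | x - p.1 ∈ A ∧ x - p.2 ∈ A} : ℝ) := by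
    exact_mod_cast key
  rw [key']
  exact this.trans (by gcongr)

/-- Averaging: if every x failed, summing the squares of the fibre sizes would give E ≤ E/4 + 16n²τ
= E/2. -/
lemma exists_popular_reflectInter {A : Finset ℝ} (hA : A.Nonempty) {τ : ℝ}
    (hτ : 64 * #A ^ 2 * τ = addEnergy A A) :
    ∃ x, (addEnergy A A : ℝ) ≤ 4 * #A ^ 2 * #(reflectInter A x) ∧
      16 * (#{p ∈ reflectInter A x ×ˢ reflectInter A x | (diffCount A (p.1 - p.2) : ℝ) < τ} : ℝ)
        ≤ #(reflectInter A x) ^ 2 := by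
  set n : ℝ := (#A : ℝ) with hn
  have hn0 : 0 < n := by simpa [hn] using hA
  have hE0 : (0 : ℝ) < addEnergy A A := by exact_mod_cast addEnergy_self_pos hA
  have hτ0 : 0 ≤ τ := by
    by_contra! h
    have : 64 * n ^ 2 * τ < 0 := mul_neg_of_pos_of_neg (by positivity) h
    linarith
  by_contra! hcon
  have hpt : ∀ x, (#(reflectInter A x) : ℝ) ^ 2 ≤
      (addEnergy A A : ℝ) / (4 * n ^ 2) * #(reflectInter A x) + 16 *
      (#{p ∈ reflectInter A x ×ˢ reflectInter A x | (diffCount A (p.1 - p.2) : ℝ) < τ} : ℝ) := by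
    intro x
    by_cases h : (addEnergy A A : ℝ) ≤ 4 * n ^ 2 * #(reflectInter A x)
    · have := hcon x h
      have : 0 ≤ (addEnergy A A : ℝ) / (4 * n ^ 2) * #(reflectInter A x) := by positivity
      linarith
    · push Not at h
      have h' : (#(reflectInter A x) : ℝ) ≤ (addEnergy A A : ℝ) / (4 * n ^ 2) := by
        rw [le_div_iff₀ (by positivity)]; linarith
      have := mul_le_mul_of_nonneg_right h' (Nat.cast_nonneg (α := ℝ) #(reflectInter A x))
      have h0 : (0 : ℝ) ≤ (#{p ∈ reflectInter A x ×ˢ reflectInter A x |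
        (diffCount A (p.1 - p.2) : ℝ) < τ} : ℝ) := Nat.cast_nonneg _
      nlinarith
  have hsum := sum_le_sum fun x (_ : x ∈ A + A) => hpt x
  rw [sum_add_distrib, ← mul_sum, ← mul_sum] at hsum
  have h1 : (addEnergy A A : ℝ) = ∑ x ∈ A + A, (#(reflectInter A x) : ℝ) ^ 2 := by
    exact_mod_cast addEnergy_eq_sum_card_reflectInter_sq A
  have h2 : (∑ x ∈ A + A, (#(reflectInter A x) : ℝ)) ≤ n ^ 2 := by
    rw [hn]
    exact_mod_cast sum_card_reflectInter_le A (A + A)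
  have h3 := sum_card_unpopular_le A (A + A) hτ0
  rw [← h1] at hsum
  have h4 : (addEnergy A A : ℝ) / (4 * n ^ 2) * (∑ x ∈ A + A, (#(reflectInter A x) : ℝ)) ≤
      addEnergy A A / 4 := by
    calc _ ≤ (addEnergy A A : ℝ) / (4 * n ^ 2) * n ^ 2 := by gcongr
      _ = _ := by field_simp
  nlinarith

/-- Balog–Szemerédi–Gowers with Schoen's exponents, for sumsets. -/
theorem exists_subset_small_sumset {A : Finset ℝ} (hA : A.Nonempty) :
    ∃ D ⊆ A, addEnergy A A ≤ 6 * #A ^ 2 * #D ∧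
      #(D + D) * addEnergy A A ^ 3 ≤ 2 ^ 15 * #A ^ 10 := by
  set n : ℝ := (#A : ℝ) with hn
  have hn0 : 0 < n := by simpa [hn] using hA
  set E : ℝ := (addEnergy A A : ℝ) with hE
  have hE0 : 0 < E := by rw [hE]; exact_mod_cast addEnergy_self_pos hA
  set τ : ℝ := E / (64 * n ^ 2) with hτdef
  have hτ0 : 0 < τ := by positivity
  have hτ : 64 * n ^ 2 * τ = E := by rw [hτdef]; field_simp
  obtain ⟨x, hx1, hx2⟩ := exists_popular_reflectInter hA hτ
  set R := reflectInter A x with hR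
  set m : ℝ := (#R : ℝ) with hm
  have hm0 : 0 < m := by
    by_contra! h
    have : 4 * n ^ 2 * m ≤ 0 := mul_nonpos_of_nonneg_of_nonpos (by positivity) h
    linarith
  let bad : ℝ → Finset ℝ := fun a => {c ∈ R | (diffCount A (a - c) : ℝ) < τ}
  let D : Finset ℝ := {a ∈ R | 4 * (#(bad a) : ℝ) ≤ m}
  have hDR : D ⊆ R := filter_subset _ _
  have hcount : (∑ a ∈ R, (#(bad a) : ℝ)) =
      (#{p ∈ R ×ˢ R | (diffCount A (p.1 - p.2) : ℝ) < τ} : ℝ) := by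
    norm_cast
    rw [card_filter, sum_product]
    refine sum_congr rfl fun a _ => ?_
    rw [card_filter]
  -- Markov: at most m²/16 pairs are unpopular, so at most m/4 elements have more than m/4 bad
  -- partners.
  have hDcard : 3 * m ≤ 4 * (#D : ℝ) := by
    have h1 : (#D : ℝ) + #(R.filter fun a => ¬ 4 * (#(bad a) : ℝ) ≤ m) = m := by
      rw [hm, ← Nat.cast_add]
      exact congrArg _ (card_filter_add_card_filter_not _)
    have h2 : (#(R.filter fun a => ¬ 4 * (#(bad a) : ℝ) ≤ m) : ℝ) * (m / 4) ≤
        ∑ a ∈ R, (#(bad a) : ℝ) := by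
      rw [← nsmul_eq_mul]
      refine (card_nsmul_le_sum _ (fun a => (#(bad a) : ℝ)) _ ?_).trans
        (sum_le_sum_of_subset_of_nonneg (filter_subset _ _) fun _ _ _ => Nat.cast_nonneg _)
      intro a ha
      have := (mem_filter.1 ha).2
      push Not at this
      linarith
    rw [hcount] at h2
    by_contra! hlt
    nlinarith
  -- For s = a + b, write s - x = (a - c) + (b - (x - c)). Since `R` is invariant under c ↦ x - c,
  -- at least m/2 choices of c make both differences popular.
  have hrep : ∀ s ∈ D + D, m / 2 * τ ^ 2 ≤
      ∑ d ∈ A - A, (diffCount A d : ℝ) * diffCount A (s - x - d) := by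
    intro s hs
    obtain ⟨a, ha, b, hb, rfl⟩ := mem_add.1 hs
    let G : Finset ℝ := {c ∈ R | τ ≤ diffCount A (a - c) ∧ τ ≤ diffCount A (b - (x - c))}
    have hG : m / 2 ≤ #G := by
      have hcov : R ⊆ G ∪ (bad a ∪ (bad b).image (fun c => x - c)) := by
        intro c hc
        by_cases h1 : τ ≤ diffCount A (a - c)
        · by_cases h2 : τ ≤ diffCount A (b - (x - c))
          · exact mem_union_left _ (mem_filter.2 ⟨hc, h1, h2⟩)
          · refine mem_union_right _ (mem_union_right _ (mem_image.2 ⟨x - c, ?_, by ring⟩))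
            exact mem_filter.2 ⟨sub_mem_reflectInter hc, not_le.1 h2⟩
        · exact mem_union_right _ (mem_union_left _ (mem_filter.2 ⟨hc, not_le.1 h1⟩))
      have h1 := (card_le_card hcov).trans ((card_union_le _ _).trans
        (Nat.add_le_add_left (card_union_le _ _) _))
      have h2 : #((bad b).image (fun c => x - c)) ≤ #(bad b) := card_image_le
      have h3 : m ≤ #G + (#(bad a) + #(bad b)) := by
        rw [hm]; exact_mod_cast h1.trans (by gcongr)
      have h4 := (mem_filter.1 ha).2
      have h5 := (mem_filter.1 hb).2
      linarith
    have hRA : R ⊆ A := filter_subset _ _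
    calc m / 2 * τ ^ 2 ≤ #G * τ ^ 2 := by gcongr
      _ = ∑ c ∈ G, τ ^ 2 := by rw [sum_const, nsmul_eq_mul]
      _ ≤ ∑ c ∈ G, (diffCount A (a - c) : ℝ) * diffCount A (a + b - x - (a - c)) := by
          refine sum_le_sum fun c hc => ?_
          obtain ⟨_, h1, h2⟩ := mem_filter.1 hc
          rw [sq, show a + b - x - (a - c) = b - (x - c) by ring]
          gcongr
      _ = ∑ d ∈ G.image (fun c => a - c), (diffCount A d : ℝ) * diffCount A (a + b - x - d) :=
          (sum_image (f := fun d => (diffCount A d : ℝ) * diffCount A (a + b - x - d))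
            (g := fun c => a - c) sub_right_injective.injOn).symm
      _ ≤ _ := by
          refine sum_le_sum_of_subset_of_nonneg ?_ fun _ _ _ => by positivity
          intro d hd
          obtain ⟨c, hc, rfl⟩ := mem_image.1 hd
          exact sub_mem_sub (hRA (hDR ha)) (hRA (mem_filter.1 hc).1)
  have htot : (#(D + D) : ℝ) * (m / 2 * τ ^ 2) ≤ n ^ 4 := by
    rw [← nsmul_eq_mul]
    refine (card_nsmul_le_sum _ _ _ hrep).trans ?_
    rw [hn]
    exact_mod_cast sum_diffCount_mul_diffCount_le A (A - A) (D + D) x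
  refine ⟨D, hDR.trans (filter_subset _ _), ?_, ?_⟩
  · have : E ≤ 6 * n ^ 2 * #D := by
      have := mul_le_mul_of_nonneg_left hDcard (by positivity : 0 ≤ n ^ 2)
      nlinarith
    rw [hE, hn] at this
    exact_mod_cast this
  · have : (#(D + D) : ℝ) * E ^ 3 ≤ 2 ^ 15 * n ^ 10 := by
      calc (#(D + D) : ℝ) * E ^ 3 = #(D + D) * (E * (64 * n ^ 2 * τ) ^ 2) := by rw [hτ]; ring
        _ ≤ #(D + D) * ((4 * n ^ 2 * m) * (64 * n ^ 2 * τ) ^ 2) := by gcongr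
        _ = 2 ^ 15 * n ^ 6 * (#(D + D) * (m / 2 * τ ^ 2)) := by ring
        _ ≤ 2 ^ 15 * n ^ 6 * n ^ 4 := by gcongr
        _ = _ := by ring
    rw [hE, hn] at this
    exact_mod_cast this

/-! ### Solymosi's sector argument -/

/-- The points of `A × A` on the line `p.1 = q * p.2`. -/
noncomputable def ratioFiber (A : Finset ℝ) (q : ℝ) : Finset (ℝ × ℝ) :=
  {p ∈ A ×ˢ A | p.1 / p.2 = q}

lemma mem_ratioFiber {A : Finset ℝ} (hA : ∀ a ∈ A, 0 < a) {q : ℝ} {p : ℝ × ℝ} :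
    p ∈ ratioFiber A q ↔ p.1 ∈ A ∧ p.2 ∈ A ∧ p.1 = q * p.2 := by
  rw [ratioFiber, mem_filter, mem_product, and_assoc]
  refine and_congr_right fun _ => and_congr_right fun h => ?_
  rw [div_eq_iff (hA _ h).ne']

lemma card_ratioFiber_le {A : Finset ℝ} (hA : ∀ a ∈ A, 0 < a) (q : ℝ) : #(ratioFiber A q) ≤ #A := by
  refine card_le_card_of_injOn Prod.snd (fun p hp => ((mem_ratioFiber hA).1 hp).2.1) ?_
  intro p hp p' hp' h
  have h1 := ((mem_ratioFiber hA).1 hp).2.2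
  have h2 := ((mem_ratioFiber hA).1 hp').2.2
  exact Prod.ext (by rw [h1, h2, h]) h

/-- The sum of a point on each of two distinct lines through 0 lies strictly between them and
determines both summands. -/
lemma card_sector_ge {A : Finset ℝ} (hA : ∀ a ∈ A, 0 < a) {q m : ℝ} (hqm : q < m) :
    #(ratioFiber A q) * #(ratioFiber A m) ≤
      #{p ∈ (A + A) ×ˢ (A + A) | q * p.2 < p.1 ∧ p.1 < m * p.2} := by
  rw [← card_product]
  refine card_le_card_of_injOn (fun u => u.1 + u.2) ?_ ?_
  · rintro ⟨⟨a, b⟩, c, d⟩ h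
    rw [mem_coe, mem_product, mem_ratioFiber hA, mem_ratioFiber hA] at h
    obtain ⟨⟨ha, hb, hab⟩, hc, hd, hcd⟩ := h
    simp only at ha hb hab hc hd hcd
    rw [mem_coe, mem_filter, mem_product]
    refine ⟨⟨add_mem_add ha hc, add_mem_add hb hd⟩, ?_, ?_⟩
    · simp only [Prod.mk_add_mk]
      nlinarith [mul_pos (sub_pos.2 hqm) (hA d hd)]
    · simp only [Prod.mk_add_mk]
      nlinarith [mul_pos (sub_pos.2 hqm) (hA b hb)]
  · rintro ⟨⟨a, b⟩, c, d⟩ h ⟨⟨a', b'⟩, c', d'⟩ h' he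
    rw [mem_coe, mem_product, mem_ratioFiber hA, mem_ratioFiber hA] at h h'
    obtain ⟨⟨-, -, hab⟩, -, -, hcd⟩ := h
    obtain ⟨⟨-, -, hab'⟩, -, -, hcd'⟩ := h'
    simp only [Prod.mk_add_mk, Prod.mk.injEq] at hab hcd hab' hcd' he
    subst hab hcd hab' hcd'
    obtain ⟨h1, h2⟩ := he
    have hd : (m - q) * (d - d') = 0 := by linear_combination h1 - q * h2
    have hd' : d = d' := by
      rcases mul_eq_zero.1 hd with h | h <;> linarith
    have hb' : b = b' := by linarith
    simp [hd', hb']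

/-- Consecutive lines bound disjoint sectors, one fewer than the lines, hence the extra t². Counting
only points below some line of `S` keeps the next sector disjoint in the induction. -/
lemma card_mul_sq_le_of_le_card_ratioFiber {A : Finset ℝ} (hA : ∀ a ∈ A, 0 < a) (t : ℕ)
    (S : Finset ℝ) (hS : ∀ q ∈ S, t ≤ #(ratioFiber A q)) :
    #S * t ^ 2 ≤ t ^ 2 + #{p ∈ (A + A) ×ˢ (A + A) | ∃ q ∈ S, p.1 < q * p.2} := by
  classical
  induction S using Finset.induction_on_max with
  | empty => simp
  | insert m S hm ih =>
    have hmS : m ∉ S := fun h => lt_irrefl _ (hm m h)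
    rw [card_insert_of_notMem hmS]
    rcases S.eq_empty_or_nonempty with rfl | hne
    · simp
    have ih' := ih fun q hq => hS q (mem_insert_of_mem hq)
    set q := S.max' hne with hq
    have hqS : q ∈ S := S.max'_mem hne
    have hsec := card_sector_ge hA (hm q hqS)
    have ht : t ^ 2 ≤ #(ratioFiber A q) * #(ratioFiber A m) := by
      rw [sq]
      exact Nat.mul_le_mul (hS q (mem_insert_of_mem hqS)) (hS m (mem_insert_self _ _))
    have hpos : ∀ p ∈ (A + A) ×ˢ (A + A), (0 : ℝ) < p.2 := by
      intro p hp
      obtain ⟨a, ha, b, hb, h⟩ := mem_add.1 (mem_product.1 hp).2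
      rw [← h]
      exact add_pos (hA a ha) (hA b hb)
    have hunion : #{p ∈ (A + A) ×ˢ (A + A) | ∃ r ∈ S, p.1 < r * p.2} +
        #{p ∈ (A + A) ×ˢ (A + A) | q * p.2 < p.1 ∧ p.1 < m * p.2} ≤
        #{p ∈ (A + A) ×ˢ (A + A) | ∃ r ∈ insert m S, p.1 < r * p.2} := by
      rw [← card_union_of_disjoint]
      · refine card_le_card (union_subset ?_ ?_)
        · intro p hp
          obtain ⟨h1, r, hr, h2⟩ := mem_filter.1 hp
          exact mem_filter.2 ⟨h1, r, mem_insert_of_mem hr, h2⟩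
        · intro p hp
          obtain ⟨h1, -, h2⟩ := mem_filter.1 hp
          exact mem_filter.2 ⟨h1, m, mem_insert_self _ _, h2⟩
      · rw [disjoint_left]
        intro p hp hp'
        obtain ⟨h1, r, hr, h2⟩ := mem_filter.1 hp
        obtain ⟨-, h3, -⟩ := mem_filter.1 hp'
        have := mul_le_mul_of_nonneg_right (S.le_max' r hr) (hpos p h1).le
        rw [← hq] at this
        linarith
    rw [add_mul, one_mul]
    omega

lemma mulEnergy_self_eq_sum_card_ratioFiber_sq {A : Finset ℝ} (hA : ∀ a ∈ A, 0 < a) :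
    mulEnergy A A = ∑ q ∈ A / A, #(ratioFiber A q) ^ 2 := by
  have hcard : mulEnergy A A =
      #{u ∈ (A ×ˢ A) ×ˢ (A ×ˢ A) | u.1.1 / u.1.2 = u.2.1 / u.2.2} := by
    unfold mulEnergy
    refine card_equiv (Equiv.prodCongr (Equiv.refl _) (Equiv.prodComm _ _)) ?_
    rintro ⟨⟨a, b⟩, c, d⟩
    simp only [mem_filter, mem_product, Equiv.prodCongr_apply, Equiv.coe_refl, Prod.map_apply, id,
      Equiv.prodComm_apply, Prod.swap_prod_mk]
    have key : b ∈ A → c ∈ A → (a * c = b * d ↔ a / b = d / c) := fun hb hc => by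
      rw [div_eq_div_iff (hA b hb).ne' (hA c hc).ne', mul_comm b d]
    tauto
  rw [hcard, card_eq_sum_card_fiberwise (f := fun u : (ℝ × ℝ) × ℝ × ℝ => u.1.1 / u.1.2)
    (t := A / A)]
  · refine sum_congr rfl fun q _ => ?_
    rw [sq, ← card_product]
    congr 1
    ext ⟨u, v⟩
    simp only [mem_filter, mem_product, ratioFiber]
    constructor
    · rintro ⟨⟨⟨hu, hv⟩, h⟩, rfl⟩
      exact ⟨⟨hu, rfl⟩, hv, h.symm⟩
    · rintro ⟨⟨hu, rfl⟩, hv, h⟩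
      exact ⟨⟨⟨hu, hv⟩, h.symm⟩, rfl⟩
  · intro u hu
    have := (mem_product.1 (mem_filter.1 (mem_coe.1 hu)).1).1
    exact mem_coe.2 (div_mem_div (mem_product.1 this).1 (mem_product.1 this).2)

lemma sq_le_sum_Icc_ite {r n : ℕ} (h : r ≤ n) :
    r ^ 2 ≤ ∑ t ∈ Icc 1 n, if t ≤ r then 2 * t else 0 := by
  rw [← sum_filter]
  have : (Icc 1 n).filter (· ≤ r) = Icc 1 r := by
    ext t
    simp only [mem_filter, mem_Icc]
    omega
  rw [this]
  clear this h
  induction r with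
  | zero => simp
  | succ k ih =>
    rw [sum_Icc_succ_top (by omega)]
    nlinarith

/-- Solymosi's bound for the multiplicative energy in terms of the sumset. -/
theorem mulEnergy_self_le_of_pos {A : Finset ℝ} (hA : ∀ a ∈ A, 0 < a) :
    (mulEnergy A A : ℝ) ≤ 4 * #(A + A) ^ 2 * (1 + Real.log #A) := by
  set N : ℝ := (#(A + A) : ℝ) with hN
  let S : ℕ → Finset ℝ := fun t => {q ∈ A / A | t ≤ #(ratioFiber A q)}
  have hle : mulEnergy A A ≤ ∑ t ∈ Icc 1 #A, 2 * t * #(S t) := by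
    rw [mulEnergy_self_eq_sum_card_ratioFiber_sq hA]
    calc _ ≤ ∑ q ∈ A / A, ∑ t ∈ Icc 1 #A, if t ≤ #(ratioFiber A q) then 2 * t else 0 :=
          sum_le_sum fun q _ => sq_le_sum_Icc_ite (card_ratioFiber_le hA q)
      _ = _ := by
          rw [sum_comm]
          refine sum_congr rfl fun t _ => ?_
          rw [← sum_filter, sum_const, smul_eq_mul, mul_comm]
  -- Here t ≤ |A| ≤ |A + A| absorbs the extra t². The resulting bound in 1/t sums to a harmonic
  -- number, the source of the logarithm.
  have hS : ∀ t ∈ Icc 1 #A, ((2 * t * #(S t) : ℕ) : ℝ) ≤ 4 * N ^ 2 * (t : ℝ)⁻¹ := by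
    intro t ht
    obtain ⟨ht1, htA⟩ := mem_Icc.1 ht
    have h1 := card_mul_sq_le_of_le_card_ratioFiber hA t (S t) fun q hq => (mem_filter.1 hq).2
    have h2 : #{p ∈ (A + A) ×ˢ (A + A) | ∃ q ∈ S t, p.1 < q * p.2} ≤ #(A + A) ^ 2 := by
      rw [sq, ← card_product]
      exact card_filter_le _ _
    have hne : A.Nonempty := card_pos.1 (by omega)
    have h3 : t ^ 2 ≤ #(A + A) ^ 2 :=
      Nat.pow_le_pow_left (htA.trans (card_le_card_add_left hne)) 2
    have h4 : (#(S t) : ℝ) * t ^ 2 ≤ 2 * N ^ 2 := by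
      rw [hN]
      exact_mod_cast (by omega : #(S t) * t ^ 2 ≤ 2 * #(A + A) ^ 2)
    have ht0 : (0 : ℝ) < t := by exact_mod_cast ht1
    rw [← div_eq_mul_inv, le_div_iff₀ ht0]
    push_cast
    nlinarith
  calc (mulEnergy A A : ℝ) ≤ ∑ t ∈ Icc 1 #A, ((2 * t * #(S t) : ℕ) : ℝ) := by exact_mod_cast hle
    _ ≤ ∑ t ∈ Icc 1 #A, 4 * N ^ 2 * (t : ℝ)⁻¹ := sum_le_sum hS
    _ = 4 * N ^ 2 * (harmonic #A : ℝ) := by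
        rw [← mul_sum, harmonic_eq_sum_Icc]
        push_cast
        rfl
    _ ≤ _ := by
        gcongr
        exact harmonic_le_one_add_log _

lemma mulEnergy_self_le_of_neg {A : Finset ℝ} (hA : ∀ a ∈ A, a < 0) :
    (mulEnergy A A : ℝ) ≤ 4 * #(A + A) ^ 2 * (1 + Real.log #A) := by
  have h := mulEnergy_self_le_of_pos (A := -A) fun a ha => by
    have := hA _ (mem_neg'.1 ha)
    linarith
  rwa [mulEnergy_neg_neg, ← neg_add, card_neg, card_neg] at h

lemma exists_subset_mulEnergy_le {D : Finset ℝ} (hD : 2 ≤ #D) :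
    ∃ F ⊆ D, 0 ∉ F ∧ #D ≤ 4 * #F ∧
      (mulEnergy F F : ℝ) ≤ 4 * #(D + D) ^ 2 * (1 + Real.log #D) := by
  have hcover : #D ≤ #{a ∈ D | 0 < a} + #{a ∈ D | a < 0} + 1 := by
    have : D ⊆ ({a ∈ D | 0 < a} ∪ {a ∈ D | a < 0}) ∪ {0} := by
      intro a ha
      rcases lt_trichotomy a 0 with h | h | h <;> simp [ha, h]
    refine (card_le_card this).trans ((card_union_le _ _).trans ?_)
    rw [card_singleton]
    gcongr
    exact card_union_le _ _
  have hmono : ∀ F ⊆ D, #D ≤ 4 * #F →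
      (mulEnergy F F : ℝ) ≤ 4 * #(F + F) ^ 2 * (1 + Real.log #F) →
      (mulEnergy F F : ℝ) ≤ 4 * #(D + D) ^ 2 * (1 + Real.log #D) := by
    intro F hF hc h
    have hF0 : (1 : ℝ) ≤ #F := by exact_mod_cast (by omega : 1 ≤ #F)
    have := Real.log_nonneg hF0
    have h1 : #(F + F) ≤ #(D + D) := card_le_card (add_subset_add hF hF)
    have h2 : #F ≤ #D := card_le_card hF
    refine h.trans ?_
    gcongr
  rcases le_total #{a ∈ D | a < 0} #{a ∈ D | 0 < a} with h | h
  · have hc : #D ≤ 4 * #{a ∈ D | 0 < a} := by omega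
    refine ⟨_, filter_subset _ _, by simp, hc, hmono _ (filter_subset _ _) hc ?_⟩
    exact mulEnergy_self_le_of_pos fun a ha => (mem_filter.1 ha).2
  · have hc : #D ≤ 4 * #{a ∈ D | a < 0} := by omega
    refine ⟨_, filter_subset _ _, by simp, hc, hmono _ (filter_subset _ _) hc ?_⟩
    exact mulEnergy_self_le_of_neg fun a ha => (mem_filter.1 ha).2

/-! ### Iterative extraction of structured pieces -/

/-- Each extracted piece raises the fourth-root bound by Q and |C| by at least w, so |C|/w bounds
the number of pieces without counting them. -/
lemma exists_decomposition_of_exists_subset {T w Q : ℝ} (hw : 0 < w) (hQ : 0 ≤ Q) (A : Finset ℝ)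
    (hstep : ∀ B ⊆ A, T < addEnergy B B →
      ∃ D ⊆ B, 0 ∉ D ∧ w ≤ #D ∧ (mulEnergy D D : ℝ) ≤ Q ^ 4) :
    ∃ B C : Finset ℝ, Disjoint B C ∧ A = B ∪ C ∧ (addEnergy B B : ℝ) ≤ T ∧ 0 ∉ C ∧
      (mulEnergy C C : ℝ) ≤ (#C / w * Q) ^ 4 := by
  induction A using Finset.strongInduction with
  | H A ih =>
    by_cases hA : (addEnergy A A : ℝ) ≤ T
    · exact ⟨A, ∅, disjoint_empty_right _, (union_empty A).symm, hA, notMem_empty _, by simp⟩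
    obtain ⟨D, hDA, hD0, hDw, hDE⟩ := hstep A Subset.rfl (not_le.1 hA)
    have hne : D.Nonempty := card_pos.1 (by exact_mod_cast hw.trans_le hDw)
    have hss : A \ D ⊂ A := sdiff_ssubset hDA hne
    obtain ⟨B, C, hBC, hABC, hBE, hC0, hCE⟩ := ih _ hss fun B hB => hstep B (hB.trans hss.subset)
    have hBD : Disjoint B D := disjoint_sdiff_self_left.mono_left (hABC ▸ subset_union_left)
    have hCD : Disjoint C D := disjoint_sdiff_self_left.mono_left (hABC ▸ subset_union_right)
    refine ⟨B, C ∪ D, disjoint_union_right.2 ⟨hBC, hBD⟩, ?_, hBE, by simp [hC0, hD0], ?_⟩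
    · rw [← union_assoc, ← hABC, sdiff_union_of_subset hDA]
    · refine (mulEnergy_union_le hC0 hD0 (by positivity) hQ hCE hDE).trans ?_
      rw [card_union_of_disjoint hCD]
      have h1 : 1 ≤ (#D : ℝ) / w := (one_le_div hw).2 hDw
      have h2 : (#C : ℝ) / w * Q + Q ≤ ((#C + #D : ℕ) : ℝ) / w * Q := by
        push_cast
        rw [add_div, add_mul]
        nlinarith
      gcongr

lemma exists_subset_mulEnergy_le_of_lt_addEnergy {B : Finset ℝ} {n δ : ℝ} (hn : 1 ≤ n)
    (hδ : δ ≤ 1) (hBn : (#B : ℝ) ≤ n) (hB : 12 * n ^ (3 - δ) < addEnergy B B) :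
    ∃ D ⊆ B, 0 ∉ D ∧ n ^ (1 - δ) / 2 ≤ #D ∧
      (mulEnergy D D : ℝ) ≤ 1600 * n ^ (2 + 6 * δ) * (1 + Real.log n) := by
  have hn0 : 0 < n := by linarith
  have hne : B.Nonempty := by
    rw [← addEnergy_self_pos_iff]
    have : (0 : ℝ) < addEnergy B B := hB.trans' (by positivity)
    exact_mod_cast this
  obtain ⟨D, hDB, hDE, hDD⟩ := exists_subset_small_sumset hne
  have hDE' : (addEnergy B B : ℝ) ≤ 6 * #B ^ 2 * #D := by exact_mod_cast hDE
  have hDD' : (#(D + D) : ℝ) * addEnergy B B ^ 3 ≤ 2 ^ 15 * #B ^ 10 := by exact_mod_cast hDD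
  have hcard : 2 * n ^ (1 - δ) ≤ #D := by
    have h1 : 12 * n ^ (3 - δ) ≤ 6 * n ^ 2 * #D := hB.le.trans (hDE'.trans (by gcongr))
    rw [show (3 : ℝ) - δ = (1 - δ) + (2 : ℕ) by push_cast; ring, Real.rpow_add_natCast hn0.ne'] at h1
    have hn2 : 0 < n ^ 2 := by positivity
    nlinarith
  -- The constant comes from 2^15 / 12^3 < 20.
  have hsum : (#(D + D) : ℝ) ≤ 20 * n ^ (1 + 3 * δ) := by
    have h1 : (#(D + D) : ℝ) * (12 * n ^ (3 - δ)) ^ 3 ≤ 2 ^ 15 * n ^ 10 := by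
      refine le_trans ?_ (hDD'.trans (by gcongr))
      gcongr
    have h2 : n ^ 10 = n ^ (1 + 3 * δ) * (n ^ (3 - δ)) ^ 3 := by
      rw [← Real.rpow_natCast, ← Real.rpow_natCast, ← Real.rpow_mul hn0.le, ← Real.rpow_add hn0]
      congr 1
      push_cast
      ring
    rw [h2] at h1
    have h3 : 0 < (n ^ (3 - δ)) ^ 3 := by positivity
    have h4 : 0 < n ^ (1 + 3 * δ) := by positivity
    by_contra! h
    have := mul_lt_mul_of_pos_right h h3
    nlinarith [mul_pos h3 h4]
  have hD2 : 2 ≤ #D := by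
    have : (1 : ℝ) ≤ n ^ (1 - δ) := Real.one_le_rpow hn (by linarith)
    exact_mod_cast (by linarith : (2 : ℝ) ≤ #D)
  obtain ⟨F, hFD, hF0, hFc, hFE⟩ := exists_subset_mulEnergy_le hD2
  refine ⟨F, hFD.trans hDB, hF0, ?_, hFE.trans ?_⟩
  · have : (#D : ℝ) ≤ 4 * #F := by exact_mod_cast hFc
    linarith
  · have hDn : (#D : ℝ) ≤ n := le_trans (by exact_mod_cast card_le_card hDB) hBn
    have hD0 : (1 : ℝ) ≤ #D := by exact_mod_cast (by omega : 1 ≤ #D)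
    have hlog := Real.log_nonneg hD0
    calc (4 : ℝ) * #(D + D) ^ 2 * (1 + Real.log #D)
        ≤ 4 * (20 * n ^ (1 + 3 * δ)) ^ 2 * (1 + Real.log n) := by gcongr
      _ = 1600 * (n ^ (1 + 3 * δ)) ^ 2 * (1 + Real.log n) := by ring
      _ = _ := by
        rw [← Real.rpow_natCast (n ^ (1 + 3 * δ)), ← Real.rpow_mul hn0.le]
        congr 3
        push_cast
        ring

/-- A decomposition into an additively and a multiplicatively unstructured part, without
logarithmic factors, for any exponent `δ < 1 / 11`. -/
theorem exists_low_energy_decomposition {δ ε : ℝ} (hδ : δ ≤ 1) (hε : 0 < ε)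
    (hδε : 11 * δ + ε ≤ 1) (A : Finset ℝ) (hA : A.Nonempty) :
    ∃ B C : Finset ℝ, Disjoint B C ∧ A = B ∪ C ∧ 0 ∉ C ∧
      (addEnergy B B : ℝ) ≤ 12 * (#A : ℝ) ^ (3 - δ) ∧
      (mulEnergy C C : ℝ) ≤ 25600 * (1 + 1 / ε) * (#A : ℝ) ^ (3 - δ) := by
  set n : ℝ := (#A : ℝ) with hn
  have hn1 : 1 ≤ n := by rw [hn]; exact_mod_cast hA.card_pos
  have hn0 : 0 < n := by linarith
  have hlog := Real.log_nonneg hn1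
  set q : ℝ := 1600 * n ^ (2 + 6 * δ) * (1 + Real.log n) with hq
  have hq0 : 0 ≤ q := by positivity
  have hQ : (√√q) ^ 4 = q := by
    rw [show 4 = 2 * 2 by norm_num, pow_mul, Real.sq_sqrt (Real.sqrt_nonneg _), Real.sq_sqrt hq0]
  obtain ⟨B, C, hBC, hABC, hBE, hC0, hCE⟩ := exists_decomposition_of_exists_subset
    (T := 12 * n ^ (3 - δ)) (w := n ^ (1 - δ) / 2) (Q := √√q) (by positivity) (by positivity) A
    fun B hB hE => by
      rw [hQ]
      exact exists_subset_mulEnergy_le_of_lt_addEnergy hn1 hδ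
        (by rw [hn]; exact_mod_cast card_le_card hB) hE
  refine ⟨B, C, hBC, hABC, hC0, hBE, hCE.trans ?_⟩
  have hCn : (#C : ℝ) ≤ n := by
    rw [hn]
    exact_mod_cast card_le_card (hABC ▸ subset_union_right)
  have hlog' : 1 + Real.log n ≤ (1 + 1 / ε) * n ^ ε := by
    have h1 := Real.log_le_rpow_div hn0.le hε
    have h2 := Real.one_le_rpow hn1 hε.le
    rw [add_mul, one_mul, one_div_mul_eq_div]
    linarith
  have hquot : n / (n ^ (1 - δ) / 2) = 2 * n ^ δ := by
    rw [Real.rpow_sub hn0, Real.rpow_one]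
    field_simp
  calc ((#C : ℝ) / (n ^ (1 - δ) / 2) * √√q) ^ 4
      ≤ (n / (n ^ (1 - δ) / 2) * √√q) ^ 4 := by gcongr
    _ = 25600 * ((n ^ δ) ^ 4 * n ^ (2 + 6 * δ)) * (1 + Real.log n) := by
        rw [hquot, mul_pow, hQ, hq]
        ring
    _ ≤ 25600 * ((n ^ δ) ^ 4 * n ^ (2 + 6 * δ)) * ((1 + 1 / ε) * n ^ ε) := by gcongr
    _ = 25600 * (1 + 1 / ε) * n ^ (2 + 10 * δ + ε) := by
        rw [show 2 + 10 * δ + ε = δ * (4 : ℕ) + (2 + 6 * δ) + ε by push_cast; ring,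
          Real.rpow_add hn0 _ ε, Real.rpow_add hn0 (δ * (4 : ℕ)), Real.rpow_mul hn0.le δ,
          Real.rpow_natCast (n ^ δ)]
        ring
    _ ≤ _ := by
        gcongr
        linarith

/-! ### Mixed energies and conclusion -/

/-- Any zero of A ends up in `B`, where Cauchy–Schwarz through quotients fails; it is split off and
contributes |C|². -/
lemma mulEnergy_le_add_sqrt_mul_sqrt {B C : Finset ℝ} (hC : 0 ∉ C) :
    (mulEnergy B C : ℝ) ≤ 2 * #C ^ 2 + 2 * (√(#B ^ 3) * √(mulEnergy C C)) := by
  have h1 : B ⊆ {0} ∪ B.erase 0 := fun b hb => by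
    by_cases h : b = 0 <;> simp [h, hb]
  have h2 : (mulEnergy B C : ℝ) ≤ mulEnergy ({0} ∪ B.erase 0) C := by
    exact_mod_cast mulEnergy_mono_left h1
  have h3 := sqrt_mulEnergy_union_left_le {0} (B.erase 0) C
  have h4 := mulEnergy_le_sqrt_mul_sqrt (notMem_erase 0 B) hC
  have h5 : (mulEnergy (B.erase 0) (B.erase 0) : ℝ) ≤ #B ^ 3 := by
    exact_mod_cast (mulEnergy_self_le (notMem_erase 0 B)).trans
      (Nat.pow_le_pow_left (card_le_card (erase_subset _ _)) 3)
  have h6 : (mulEnergy (B.erase 0) C : ℝ) ≤ √(#B ^ 3) * √(mulEnergy C C) :=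
    h4.trans (by gcongr)
  have h7 : (mulEnergy {0} C : ℝ) = #C ^ 2 := by exact_mod_cast mulEnergy_singleton_zero_left
  have e0 := Real.sq_sqrt (Nat.cast_nonneg (α := ℝ) (mulEnergy ({0} ∪ B.erase 0) C))
  have e1 := Real.sq_sqrt (Nat.cast_nonneg (α := ℝ) (mulEnergy {0} C))
  have e2 := Real.sq_sqrt (Nat.cast_nonneg (α := ℝ) (mulEnergy (B.erase 0) C))
  have h8 := pow_le_pow_left₀ (Real.sqrt_nonneg _) h3 2
  nlinarith [sq_nonneg (√(mulEnergy {0} C : ℝ) - √(mulEnergy (B.erase 0) C : ℝ))]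

/-- Lets the logarithmic factor be inserted for free, even at n = 2 where log n < 1. -/
lemma one_le_two_mul_log_rpow {n s : ℝ} (hn : 2 ≤ n) (hs0 : 0 ≤ s) (hs1 : s ≤ 1) :
    1 ≤ 2 * Real.log n ^ s := by
  have h1 : (1 / 2 : ℝ) ≤ Real.log n := by
    have := Real.log_le_log two_pos hn
    linarith [Real.log_two_gt_d9]
  have h2 : (1 / 2 : ℝ) ≤ (1 / 2 : ℝ) ^ s := by
    simpa using Real.rpow_le_rpow_of_exponent_ge (by norm_num : (0 : ℝ) < 1 / 2) (by norm_num) hs1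
  have h3 := Real.rpow_le_rpow (by norm_num : (0 : ℝ) ≤ 1 / 2) h1 hs0
  linarith

theorem theorem1p1 (δ : ℝ) (hδ : δ = 2 / 33) :
    ∃ K : ℝ, 0 < K ∧ ∀ A : Finset ℝ, 2 ≤ A.card →
      ∃ B C : Finset ℝ, Disjoint B C ∧ A = B ∪ C ∧
        max (Finset.addEnergy B B : ℝ) (Finset.mulEnergy C C : ℝ) ≤
          K * ((A.card : ℝ) ^ (3 - δ) * Real.log (A.card : ℝ) ^ (1 - δ)) ∧
        max (Finset.addEnergy B C : ℝ) (Finset.mulEnergy B C : ℝ) ≤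
          K * ((A.card : ℝ) ^ (3 - δ / 2) * Real.log (A.card : ℝ) ^ ((1 - δ) / 2)) := by
  -- This is 2 · 25600 · (1 + 3), the 2 paying for the logarithmic factor; ε = 1/3 gives 11δ + ε = 1
  -- exactly.
  refine ⟨204800, by norm_num, fun A hA => ?_⟩
  obtain ⟨B, C, hBC, hABC, hC0, hBE, hCE⟩ := exists_low_energy_decomposition (δ := δ) (ε := 1 / 3)
    (by linarith) (by norm_num) (by linarith) A (card_pos.1 (by omega))
  refine ⟨B, C, hBC, hABC, ?_⟩
  set n : ℝ := (#A : ℝ) with hn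
  have hn2 : 2 ≤ n := by rw [hn]; exact_mod_cast hA
  have hn0 : 0 < n := by linarith
  have hn1 : 1 ≤ n := by linarith
  have hBn : (#B : ℝ) ≤ n := by
    rw [hn]
    exact_mod_cast card_le_card (hABC ▸ subset_union_left)
  have hCn : (#C : ℝ) ≤ n := by
    rw [hn]
    exact_mod_cast card_le_card (hABC ▸ subset_union_right)
  set P : ℝ := n ^ (3 - δ) with hP
  set R : ℝ := n ^ (3 - δ / 2) with hR
  have hP0 : 0 < P := by positivity
  have hR0 : 0 < R := by positivity
  have hsqrt : √(n ^ 3) * √P = R := by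
    rw [← Real.sqrt_mul (by positivity), hP, hR, ← Real.rpow_natCast n 3, ← Real.rpow_add hn0,
      Real.sqrt_eq_rpow, ← Real.rpow_mul hn0.le]
    congr 1
    push_cast
    ring
  have hCE' : (mulEnergy C C : ℝ) ≤ 320 ^ 2 * P := hCE.trans (le_of_eq (by ring))
  have hBE' : (addEnergy B B : ℝ) ≤ 4 ^ 2 * P := hBE.trans (by gcongr; norm_num)
  have hroot : ∀ c : ℝ, 0 ≤ c → √(c ^ 2 * P) = c * √P := fun c hc => by
    rw [Real.sqrt_mul (by positivity), Real.sqrt_sq hc]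
  have hadd : (addEnergy B C : ℝ) ≤ 4 * R := by
    have h1 : (addEnergy C C : ℝ) ≤ n ^ 3 :=
      le_trans (by exact_mod_cast addEnergy_self_le C) (pow_le_pow_left₀ (Nat.cast_nonneg _) hCn 3)
    calc (addEnergy B C : ℝ) ≤ √(addEnergy B B) * √(addEnergy C C) := addEnergy_le_sqrt_mul_sqrt B C
      _ ≤ √(4 ^ 2 * P) * √(n ^ 3) := by gcongr
      _ = 4 * R := by rw [hroot 4 (by norm_num), ← hsqrt]; ring
  have hmul : (mulEnergy B C : ℝ) ≤ 642 * R := by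
    have h1 : n ^ 2 ≤ R := by
      rw [hR, ← Real.rpow_natCast]
      exact Real.rpow_le_rpow_of_exponent_le hn1 (by push_cast; linarith)
    calc (mulEnergy B C : ℝ) ≤ 2 * #C ^ 2 + 2 * (√(#B ^ 3) * √(mulEnergy C C)) :=
          mulEnergy_le_add_sqrt_mul_sqrt hC0
      _ ≤ 2 * n ^ 2 + 2 * (√(n ^ 3) * √(320 ^ 2 * P)) := by gcongr
      _ = 2 * n ^ 2 + 640 * R := by rw [hroot 320 (by norm_num), ← hsqrt]; ring
      _ ≤ _ := by linarith
  have hL1 := one_le_two_mul_log_rpow (s := 1 - δ) hn2 (by linarith) (by linarith)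
  have hL2 := one_le_two_mul_log_rpow (s := (1 - δ) / 2) hn2 (by linarith) (by linarith)
  have hP1 := mul_le_mul_of_nonneg_left hL1 hP0.le
  have hR1 := mul_le_mul_of_nonneg_left hL2 hR0.le
  exact ⟨max_le (by linarith) (by linarith), max_le (by linarith) (by linarith)⟩
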